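/- Let $L>0$, let $a\in C^2(\mathbb R,\mathbb R)$ be positive and $L$-periodic, and let $f\in C^1(\mathbb R^2,\mathbb R)$ satisfy $f(x+L,u)=f(x,u)$ for all $(x,u)$. Consider the equation $$\partial_t u=\partial_x\big(a(x)\,\partial_x u\big)+f(x,u),\qquad (t,x)\in\mathbb R\times\mathbb R. \tag{E}$$ For $L$-periodic $C^2$ stationary solutions $r<q$ of (E), a *pulsating wave connecting $r$ to $q$ with speed $c\in\mathbb R$* is a classical entire solution of (E) of the form $u(t,x)=P(x-ct,x)$, where $P(z,x)$ is $L$-periodic in $x$, $P(z,\cdot)\to q$ uniformly as $z\to-\infty$ and $P(z,\cdot)\to r$ uniformly as $z\to+\infty$. A function $u_1(t,x)$ is *steeper than* $u_2(t,x)$ if, for all $x_1,t_1,t_2\in\mathbb R$, the equality $u_1(t_1,x_1)=u_2(t_2,x_1)$ implies $u_1(t_1,x)\ge u_2(t_2,x)$ for all $x\le x_1$ and $u_1(t_1,x)\le u_2(t_2,x)$ for all $x\ge x_1$. For an $L$-periodic function $g$, the *principal eigenvalue* $\mu_g$ is the real number for which there is a positive $L$-periodic $\varphi\in C^2(\mathbb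 R)$ with $(a\varphi')'+g\varphi=\mu_g\varphi$ on $\mathbb R$. Let $q,q_1,q_2$ be $L$-periodic stationary solutions of (E) with $q_1<q$ and $q_2<q$ on $\mathbb R$, and let $U_1,U_2$ be pulsating waves connecting $q_1$ to $q$ and $q_2$ to $q$, with speeds $c_1$ and $c_2$ respectively, where $U_1\le q$ on $\mathbb R^2$. Assume that there are $\delta>0$ and an $L$-periodic function $g$ that has a principal eigenvalue $\mu_g\le 0$ such that $$\partial_u f(x,u)\le g(x)\quad\text{for all }x\in\mathbb R\text{ and }u\in[q(x)-\delta,q(x)],$$ and assume that $U_1$ is steeper than $U_2$. Then $c_1\le c_2$. Moreover, if $c_1=c_2\neq 0$, then there is $\tau\in\mathbb R$ such that $U_2(t,x)=U_1(t+\tau,x)$ for all $(t,x)\in\mathbb R^2$. -/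

import Mathlib

open Filter Topology

namespace PeriodicRD

/-- A classical entire solution `u(t,x)` of `∂ₜ u = ∂ₓ (a(x) ∂ₓ u) + f(x,u)` on `ℝ × ℝ`:
`u` is `C¹` in `t` and `C²` in `x`, and satisfies the equation at every point. -/
structure IsEntireSolution (a : ℝ → ℝ) (f : ℝ → ℝ → ℝ) (u : ℝ → ℝ → ℝ) : Prop where
  cont : Continuous fun z : ℝ × ℝ => u z.1 z.2
  diff_t : ∀ x, Differentiable ℝ fun t => u t x
  diff_x : ∀ t, Differentiable ℝ (u t)
  diff_xx : ∀ t, Differentiable ℝ (deriv (u t))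
  cont_t : Continuous fun z : ℝ × ℝ => deriv (fun s => u s z.2) z.1
  cont_x : Continuous fun z : ℝ × ℝ => deriv (u z.1) z.2
  cont_xx : Continuous fun z : ℝ × ℝ => deriv (deriv (u z.1)) z.2
  eqn : ∀ t x, deriv (fun s => u s x) t
    = deriv (fun y => a y * deriv (u t) y) x + f x (u t x)

/-- An `L`-periodic stationary solution `q` of the equation. -/
structure IsPeriodicStationary (L : ℝ) (a : ℝ → ℝ) (f : ℝ → ℝ → ℝ) (q : ℝ → ℝ) : Prop where
  smooth : ContDiff ℝ 2 q
  periodic : Function.Periodic q L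
  eqn : ∀ x, deriv (fun y => a y * deriv q y) x + f x (q x) = 0

/-- `u` is a pulsating traveling wave of speed `c` connecting `r` to `q`: the `L`-periodic
stationary solution `q` is the limit on the left and `r` the limit on the right. The function
`P` is the profile, `u(t,x) = P(x - c t, x)`. -/
structure IsPulsatingWave (L : ℝ) (a : ℝ → ℝ) (f : ℝ → ℝ → ℝ) (c : ℝ) (r q : ℝ → ℝ)
    (u : ℝ → ℝ → ℝ) : Prop where
  right_state : IsPeriodicStationary L a f r
  left_state : IsPeriodicStationary L a f q
  solution : IsEntireSolution a f u
  profile : ∃ P : ℝ → ℝ → ℝ,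
    (∀ z, Function.Periodic (P z) L) ∧
    (∀ t x, u t x = P (x - c * t) x) ∧
    TendstoUniformly P q atBot ∧
    TendstoUniformly P r atTop

/-- `u₁` is steeper than `u₂`. -/
def Steeper (u₁ u₂ : ℝ → ℝ → ℝ) : Prop :=
  ∀ x₁ t₁ t₂ : ℝ, u₁ t₁ x₁ = u₂ t₂ x₁ →
    (∀ x ≤ x₁, u₂ t₂ x ≤ u₁ t₁ x) ∧ (∀ x, x₁ ≤ x → u₁ t₁ x ≤ u₂ t₂ x)

/-- `μ` is the principal eigenvalue of `φ ↦ (a φ')' + g φ` on `L`-periodic functions, that is,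
the eigenvalue that has a positive eigenfunction. -/
def IsPrincipalEigenvalue (L : ℝ) (a g : ℝ → ℝ) (μ : ℝ) : Prop :=
  ∃ φ : ℝ → ℝ, ContDiff ℝ 2 φ ∧ Function.Periodic φ L ∧ (∀ x, 0 < φ x) ∧
    ∀ x, deriv (fun y => a y * deriv φ y) x + g x * φ x = μ * φ x

end PeriodicRD

/-!
An eigenfunction `φ` for a nonpositive principal eigenvalue is a supersolution of the linearization
at every state just below `q`. Hence, to the left of a line moving with the speed of `U₂`, far
enough that `U₂ ≥ q - δ` there, `m φ - (U₁ - U₂)` with `m > 0` obeys a maximum principle where it is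
negative, and letting `m → 0`, or looking at the contact set of `m φ` and `U₁ - U₂`, an ordering
`U₁ ≤ U₂` on the line extends to its left. Steepness extends it to the right.

If `c₂ < c₁`, then `U₁ < U₂` on such a line for very negative times, but not for all times, since
the faster wave `U₁` overtakes `U₂`. At the first time at which they meet on the line, `U₁ ≤ U₂`
holds at all earlier times, so the contact contradicts the strong maximum principle.

If `c₁ = c₂ ≠ 0`, slide `U₁` in time up to the last position at which it lies below `U₂`. Unless
the two waves coincide there, they are strictly ordered, by a fixed amount on the line since the
joint translation by `(L / c, L)` leaves both waves invariant. A slightly larger shift then keeps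
the ordering on the line, hence everywhere.
-/

namespace PeriodicRD

open Set

/-! ### Maximum principles -/

theorem deriv_deriv_nonneg_of_isLocalMin {h : ℝ → ℝ} {x : ℝ} (hmin : IsLocalMin h x)
    (hc : ContinuousAt h x) : 0 ≤ deriv (deriv h) x := by
  by_contra! hneg
  have hmax : IsLocalMax h x := isLocalMax_of_deriv_deriv_neg hneg hmin.deriv_eq_zero hc
  have hconst : h =ᶠ[𝓝 x] fun _ => h x := by
    filter_upwards [hmin, hmax] with y hge hle using le_antisymm hle hge
  have hzero : deriv (deriv h) x = 0 := by simpa using hconst.deriv.deriv_eq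
  exact hneg.ne hzero

theorem hasDerivAt_nonpos_of_eventually_le_left {h : ℝ → ℝ} {d t : ℝ} (hd : HasDerivAt h d t)
    (hle : ∀ᶠ r in 𝓝[<] t, h t ≤ h r) : d ≤ 0 := by
  refine le_of_tendsto (hasDerivAt_iff_tendsto_slope_left_right.1 hd).1 ?_
  filter_upwards [hle, self_mem_nhdsWithin] with r hr hrt
  rw [slope_comm]
  exact (slope_nonpos_iff_of_le (le_of_lt hrt)).2 hr

/-- `v` is continuous, and `vt`, `vx`, `vxx` are the partial derivatives of `v` that occur in a
second order parabolic equation. Naming the derivatives keeps them explicit under sums and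
products. -/
structure HasParabolicDerivs (v vt vx vxx : ℝ → ℝ → ℝ) : Prop where
  cont : Continuous fun z : ℝ × ℝ => v z.1 z.2
  time : ∀ t x, HasDerivAt (fun s => v s x) (vt t x) t
  space : ∀ t x, HasDerivAt (v t) (vx t x) x
  space₂ : ∀ t x, HasDerivAt (vx t) (vxx t x) x

/-- The set of `(t, x)` with `t ∈ [t₀, T]` and `x` between the parallel lines `x = α + s t` and
`x = β + s t`. -/
def slantedStrip (t₀ T s α β : ℝ) : Set (ℝ × ℝ) :=
  {p | p.1 ∈ Icc t₀ T ∧ p.2 - s * p.1 ∈ Icc α β}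

theorem isCompact_slantedStrip (t₀ T s α β : ℝ) : IsCompact (slantedStrip t₀ T s α β) := by
  have hshear : Continuous fun p : ℝ × ℝ => (p.1, p.2 + s * p.1) := by fun_prop
  convert ((isCompact_Icc (a := t₀) (b := T)).prod (isCompact_Icc (a := α) (b := β))).image hshear
    using 1
  ext ⟨t, x⟩
  simp only [slantedStrip, mem_ofPred_eq, mem_image, mem_prod, Prod.mk.injEq, Prod.exists]
  constructor
  · rintro ⟨ht, hx⟩
    exact ⟨t, x - s * t, ⟨ht, hx⟩, rfl, by ring⟩
  · rintro ⟨t, y, ⟨ht, hy⟩, rfl, rfl⟩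
    exact ⟨ht, by simpa using hy⟩

namespace HasParabolicDerivs

variable {v vt vx vxx w wt wx wxx : ℝ → ℝ → ℝ}

theorem sub (hv : HasParabolicDerivs v vt vx vxx) (hw : HasParabolicDerivs w wt wx wxx) :
    HasParabolicDerivs (fun t x => v t x - w t x) (fun t x => vt t x - wt t x)
      (fun t x => vx t x - wx t x) (fun t x => vxx t x - wxx t x) where
  cont := hv.cont.sub hw.cont
  time t x := (hv.time t x).sub (hw.time t x)
  space t x := (hv.space t x).sub (hw.space t x)
  space₂ t x := (hv.space₂ t x).sub (hw.space₂ t x)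

theorem const_mul (m : ℝ) (hv : HasParabolicDerivs v vt vx vxx) :
    HasParabolicDerivs (fun t x => m * v t x) (fun t x => m * vt t x)
      (fun t x => m * vx t x) (fun t x => m * vxx t x) where
  cont := hv.cont.const_mul m
  time t x := (hv.time t x).const_mul m
  space t x := (hv.space t x).const_mul m
  space₂ t x := (hv.space₂ t x).const_mul m

theorem of_isMinOn_exp_mul (hv : HasParabolicDerivs v vt vx vxx) {t₀ T s α β Λ t x : ℝ}
    (ht : t ∈ Ioc t₀ T) (hx : x - s * t ∈ Ioo α β)
    (hmin : IsMinOn (fun p : ℝ × ℝ => Real.exp (-Λ * p.1) * v p.1 p.2)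
      (slantedStrip t₀ T s α β) (t, x)) :
    vx t x = 0 ∧ 0 ≤ vxx t x ∧ vt t x ≤ Λ * v t x := by
  have hspace : IsLocalMin (v t) x := by
    have hnear : ∀ᶠ y in 𝓝 x, y - s * t ∈ Ioo α β :=
      ContinuousAt.eventually_mem (by fun_prop) (isOpen_Ioo.mem_nhds hx)
    filter_upwards [hnear] with y hy
    exact le_of_mul_le_mul_left
      (hmin (show (t, y) ∈ slantedStrip t₀ T s α β from
        ⟨Ioc_subset_Icc_self ht, Ioo_subset_Icc_self hy⟩))
      (Real.exp_pos _)
  have htime : ∀ᶠ r in 𝓝[<] t, Real.exp (-Λ * t) * v t x ≤ Real.exp (-Λ * r) * v r x := by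
    have hnear : ∀ᶠ r in 𝓝 t, t₀ < r ∧ x - s * r ∈ Ioo α β :=
      (lt_mem_nhds ht.1).and
        (ContinuousAt.eventually_mem (by fun_prop) (isOpen_Ioo.mem_nhds hx))
    filter_upwards [hnear.filter_mono nhdsWithin_le_nhds, self_mem_nhdsWithin] with r hr hrt
    exact hmin (show (r, x) ∈ slantedStrip t₀ T s α β from
      ⟨⟨hr.1.le, (le_of_lt hrt).trans ht.2⟩, Ioo_subset_Icc_self hr.2⟩)
  have hderiv : HasDerivAt (fun r => Real.exp (-Λ * r) * v r x)
      (Real.exp (-Λ * t) * (vt t x - Λ * v t x)) t :=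
    (((hasDerivAt_id t).const_mul (-Λ)).exp.mul (hv.time t x)).congr_deriv (by simp; ring)
  refine ⟨hspace.hasDerivAt_eq_zero (hv.space t x), ?_, ?_⟩
  · have hvx : deriv (v t) = vx t := funext fun y => (hv.space t y).deriv
    have := deriv_deriv_nonneg_of_isLocalMin hspace (hv.space t x).continuousAt
    rwa [hvx, (hv.space₂ t x).deriv] at this
  · have := hasDerivAt_nonpos_of_eventually_le_left hderiv htime
    exact sub_nonpos.1 (nonpos_of_mul_nonpos_right this (Real.exp_pos _))

/-- The differential inequality is only needed where a negative minimum could sit. -/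
theorem nonneg_on_slantedStrip (hv : HasParabolicDerivs v vt vx vxx) {t₀ T s α β Λ : ℝ}
    (hbase : ∀ x, x - s * t₀ ∈ Icc α β → 0 ≤ v t₀ x)
    (hleft : ∀ t ∈ Icc t₀ T, 0 ≤ v t (α + s * t))
    (hright : ∀ t ∈ Icc t₀ T, 0 ≤ v t (β + s * t))
    (hint : ∀ t ∈ Ioc t₀ T, ∀ x, x - s * t ∈ Ioo α β → v t x < 0 →
      vx t x = 0 → 0 ≤ vxx t x → Λ * v t x < vt t x)
    {t x : ℝ} (htx : (t, x) ∈ slantedStrip t₀ T s α β) : 0 ≤ v t x := by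
  by_contra! hneg
  have hcont : Continuous fun p : ℝ × ℝ => Real.exp (-Λ * p.1) * v p.1 p.2 := by
    have := hv.cont
    fun_prop
  obtain ⟨⟨t₁, x₁⟩, ⟨ht₁, hx₁⟩, hmin⟩ :=
    (isCompact_slantedStrip t₀ T s α β).exists_isMinOn ⟨(t, x), htx⟩ hcont.continuousOn
  dsimp only at ht₁ hx₁
  have hneg₁ : v t₁ x₁ < 0 := by
    have hle : Real.exp (-Λ * t₁) * v t₁ x₁ ≤ Real.exp (-Λ * t) * v t x := hmin htx
    have hlt := hle.trans_lt (mul_neg_of_pos_of_neg (Real.exp_pos _) hneg)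
    exact neg_of_mul_neg_right hlt (Real.exp_pos _).le
  have ht₁' : t₁ ∈ Ioc t₀ T := by
    refine ⟨lt_of_le_of_ne ht₁.1 ?_, ht₁.2⟩
    rintro rfl
    exact hneg₁.not_ge (hbase x₁ hx₁)
  have hx₁' : x₁ - s * t₁ ∈ Ioo α β := by
    refine ⟨lt_of_le_of_ne hx₁.1 fun h => ?_, lt_of_le_of_ne hx₁.2 fun h => ?_⟩
    · exact hneg₁.not_ge (by simpa [h] using hleft t₁ ht₁)
    · exact hneg₁.not_ge (by simpa [← h] using hright t₁ ht₁)
  obtain ⟨hvx, hvxx, hvt⟩ := hv.of_isMinOn_exp_mul ht₁' hx₁' hmin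
  exact (hint t₁ ht₁' x₁ hx₁' hneg₁ hvx hvxx).not_ge hvt

end HasParabolicDerivs

/-- The profile of the barrier in the strong maximum principle, positive for `|y| < R` and flat
at `y = ±R`. -/
def bump (R y : ℝ) : ℝ := (R ^ 2 - y ^ 2) ^ 2

theorem hasDerivAt_bump (R y : ℝ) :
    HasDerivAt (bump R) (-4 * y * (R ^ 2 - y ^ 2)) y :=
  ((((hasDerivAt_id y).pow 2).const_sub (R ^ 2)).pow 2).congr_deriv (by simp; ring)

theorem hasDerivAt_deriv_bump (R y : ℝ) :
    HasDerivAt (fun y => -4 * y * (R ^ 2 - y ^ 2)) (8 * y ^ 2 - 4 * (R ^ 2 - y ^ 2)) y :=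
  (((hasDerivAt_id y).const_mul (-4)).mul
    (((hasDerivAt_id y).pow 2).const_sub (R ^ 2))).congr_deriv (by simp; ring)

theorem bump_le {R y : ℝ} (hy : |y| ≤ R) : bump R y ≤ R ^ 4 := by
  have hle : y ^ 2 ≤ R ^ 2 := sq_le_sq' (abs_le.1 hy).1 (abs_le.1 hy).2
  calc bump R y ≤ (R ^ 2) ^ 2 :=
        pow_le_pow_left₀ (sub_nonneg.2 hle) (sub_le_self _ (sq_nonneg y)) 2
    _ = R ^ 4 := by ring

/-- Completing the square twice absorbs the drift into `B² / a₀` and the diffusion into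
`4 A / R²`. -/
theorem bump_subsolution {a a₀ A b B R N y : ℝ} (ha₀ : 0 < a₀) (ha : a₀ ≤ a) (hA : a ≤ A)
    (hb : |b| ≤ B) (hN : B ^ 2 / a₀ + 4 * A / R ^ 2 < N) (hy : |y| < R) :
    0 < a * (8 * y ^ 2 - 4 * (R ^ 2 - y ^ 2)) + b * (-4 * y * (R ^ 2 - y ^ 2)) + N * bump R y := by
  have hR : 0 < R := (abs_nonneg y).trans_lt hy
  have hp : 0 < R ^ 2 - y ^ 2 := sub_pos.2 (sq_lt_sq.2 (by rwa [abs_of_pos hR]))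
  rw [bump]
  obtain ⟨p, hpR⟩ : ∃ p, p = R ^ 2 - y ^ 2 := ⟨_, rfl⟩
  rw [← hpR] at hp ⊢
  have hdrift : 0 ≤ 4 * a₀ * y ^ 2 - 4 * b * y * p + b ^ 2 / a₀ * p ^ 2 :=
    calc 0 ≤ (2 * a₀ * y - b * p) ^ 2 / a₀ := by positivity
      _ = _ := by field_simp; ring
  have hdiffusion : 0 ≤ 4 * a * y ^ 2 - 4 * a * p + 4 * a / R ^ 2 * p ^ 2 :=
    calc 0 ≤ 4 * a * (R - p / R) ^ 2 := by have := ha₀.trans_le ha; positivity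
      _ = _ := by rw [show y ^ 2 = R ^ 2 - p by rw [hpR]; ring]; field_simp; ring
  have hcoeff : b ^ 2 / a₀ + 4 * a / R ^ 2 < N :=
    calc b ^ 2 / a₀ + 4 * a / R ^ 2 ≤ B ^ 2 / a₀ + 4 * A / R ^ 2 := by
          have : b ^ 2 ≤ B ^ 2 := sq_le_sq' (abs_le.1 hb).1 (abs_le.1 hb).2
          gcongr
      _ < N := hN
  have hgain := mul_lt_mul_of_pos_right hcoeff (pow_pos hp 2)
  have hellipticity := mul_le_mul_of_nonneg_right ha (sq_nonneg y)
  linarith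

theorem hasParabolicDerivs_exp_mul_traveling {p p' p'' : ℝ → ℝ}
    (hp : ∀ y, HasDerivAt p (p' y) y) (hp' : ∀ y, HasDerivAt p' (p'' y) y) (Λ s t₀ ξ : ℝ) :
    HasParabolicDerivs (fun t x => Real.exp (-Λ * (t - t₀)) * p (x - s * t - ξ))
      (fun t x => Real.exp (-Λ * (t - t₀)) * (-Λ * p (x - s * t - ξ) - s * p' (x - s * t - ξ)))
      (fun t x => Real.exp (-Λ * (t - t₀)) * p' (x - s * t - ξ))
      (fun t x => Real.exp (-Λ * (t - t₀)) * p'' (x - s * t - ξ)) where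
  cont := by
    have : Continuous p := continuous_iff_continuousAt.2 fun y => (hp y).continuousAt
    fun_prop
  time t x := by
    have hexp : HasDerivAt (fun r => Real.exp (-Λ * (r - t₀)))
        (Real.exp (-Λ * (t - t₀)) * (-Λ * 1)) t :=
      (((hasDerivAt_id t).sub_const t₀).const_mul (-Λ)).exp
    have hline : HasDerivAt (fun r => x - s * r - ξ) (-(s * 1)) t :=
      (((hasDerivAt_id t).const_mul s).const_sub x).sub_const ξ
    exact (hexp.mul ((hp _).comp t hline)).congr_deriv (by simp only [Function.comp_apply]; ring)
  space t x := by
    have hline := ((hasDerivAt_id x).sub_const (s * t)).sub_const ξ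
    exact (((hp _).comp x hline).const_mul _).congr_deriv (by simp)
  space₂ t x := by
    have hline := ((hasDerivAt_id x).sub_const (s * t)).sub_const ξ
    exact (((hp' _).comp x hline).const_mul _).congr_deriv (by simp)

namespace HasParabolicDerivs

variable {v vt vx vxx : ℝ → ℝ → ℝ} {a b : ℝ × ℝ → ℝ}

theorem exp_mul_bump_le (hv : HasParabolicDerivs v vt vx vxx) {a₀ A B M N ε t₀ T s ξ R : ℝ}
    (ha₀ : 0 < a₀) (hR : 0 < R) (hε : 0 < ε) (hN : B ^ 2 / a₀ + 4 * A / R ^ 2 < N)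
    (hcoeff : ∀ p ∈ slantedStrip t₀ T s (ξ - R) (ξ + R), a₀ ≤ a p ∧ a p ≤ A ∧ |b p + s| ≤ B)
    (hnonneg : ∀ t x, (t, x) ∈ slantedStrip t₀ T s (ξ - R) (ξ + R) → 0 ≤ v t x)
    (hsup : ∀ t x, (t, x) ∈ slantedStrip t₀ T s (ξ - R) (ξ + R) →
      a (t, x) * vxx t x + b (t, x) * vx t x - M * v t x ≤ vt t x)
    (hbase : ∀ x, x - s * t₀ ∈ Icc (ξ - R) (ξ + R) → ε * R ^ 4 ≤ v t₀ x) {t x : ℝ}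
    (htx : (t, x) ∈ slantedStrip t₀ T s (ξ - R) (ξ + R)) :
    ε * (Real.exp (-(|M| + N) * (t - t₀)) * bump R (x - s * t - ξ)) ≤ v t x := by
  have hdiff := hv.sub ((hasParabolicDerivs_exp_mul_traveling (hasDerivAt_bump R)
    (hasDerivAt_deriv_bump R) (|M| + N) s t₀ ξ).const_mul ε)
  refine sub_nonneg.1 (hdiff.nonneg_on_slantedStrip (Λ := 0) ?_ ?_ ?_ ?_ htx)
  · intro y hy
    have hbump : bump R (y - s * t₀ - ξ) ≤ R ^ 4 :=
      bump_le (abs_le.2 ⟨by linarith [hy.1], by linarith [hy.2]⟩)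
    simpa using (mul_le_mul_of_nonneg_left hbump hε.le).trans (hbase y hy)
  · intro r hr
    simpa [bump] using hnonneg r (ξ - R + s * r) ⟨hr, by constructor <;> simp; linarith⟩
  · intro r hr
    simpa [bump] using hnonneg r (ξ + R + s * r) ⟨hr, by constructor <;> simp; linarith⟩
  · intro r hr y hy hneg hvx hvxx
    have hmem : (r, y) ∈ slantedStrip t₀ T s (ξ - R) (ξ + R) :=
      ⟨Ioc_subset_Icc_self hr, Ioo_subset_Icc_self hy⟩
    obtain ⟨ha, hA, hB⟩ := hcoeff _ hmem
    have hbump := bump_subsolution ha₀ ha hA hB hN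
      (y := y - s * r - ξ) (abs_lt.2 ⟨by linarith [hy.1], by linarith [hy.2]⟩)
    have hE : 0 < ε * Real.exp (-(|M| + N) * (r - t₀)) := by positivity
    have hMv : M * v r y ≤
        |M| * (ε * (Real.exp (-(|M| + N) * (r - t₀)) * bump R (y - s * r - ξ))) :=
      calc M * v r y ≤ |M| * v r y :=
            mul_le_mul_of_nonneg_right (le_abs_self M) (hnonneg r y hmem)
        _ ≤ _ := mul_le_mul_of_nonneg_left (sub_neg.1 hneg).le (abs_nonneg M)
    have hdiffusion := mul_nonneg (ha₀.le.trans ha) hvxx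
    have hdrift := congrArg (b (r, y) * ·) hvx
    have hgain := mul_pos hE hbump
    linarith [hsup r y hmem]

theorem pos_of_slantedStrip (hv : HasParabolicDerivs v vt vx vxx) (ha : Continuous a)
    (hb : Continuous b) (ha_pos : ∀ p, 0 < a p) {t₀ T s ξ ρ M : ℝ} (hT : t₀ ≤ T) (hρ : 0 < ρ)
    (hnonneg : ∀ t x, (t, x) ∈ slantedStrip t₀ T s (ξ - ρ) (ξ + ρ) → 0 ≤ v t x)
    (hsup : ∀ t x, (t, x) ∈ slantedStrip t₀ T s (ξ - ρ) (ξ + ρ) →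
      a (t, x) * vxx t x + b (t, x) * vx t x - M * v t x ≤ vt t x)
    (hpos : 0 < v t₀ (ξ + s * t₀)) : 0 < v T (ξ + s * T) := by
  obtain ⟨m, hm, hmpos⟩ := exists_between hpos
  obtain ⟨r, hr, hbase⟩ := Metric.eventually_nhds_iff.1
    ((hv.space t₀ (ξ + s * t₀)).continuousAt.eventually (lt_mem_nhds hmpos))
  obtain ⟨R, hR, hRmin⟩ := exists_between (lt_min hρ hr)
  obtain ⟨hRρ, hRr⟩ := lt_min_iff.1 hRmin
  have hsub : slantedStrip t₀ T s (ξ - R) (ξ + R) ⊆ slantedStrip t₀ T s (ξ - ρ) (ξ + ρ) :=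
    fun p hp => ⟨hp.1, Icc_subset_Icc (by linarith) (by linarith) hp.2⟩
  have hcenter : (T, ξ + s * T) ∈ slantedStrip t₀ T s (ξ - R) (ξ + R) :=
    ⟨⟨hT, le_rfl⟩, by constructor <;> simp [hR.le]⟩
  have hK := isCompact_slantedStrip t₀ T s (ξ - R) (ξ + R)
  obtain ⟨p, -, hamin⟩ := hK.exists_isMinOn ⟨_, hcenter⟩ ha.continuousOn
  obtain ⟨A, hA⟩ := hK.bddAbove_image ha.continuousOn
  obtain ⟨B, hB⟩ := hK.bddAbove_image (hb.add_const s).abs.continuousOn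
  have hε : 0 < m / R ^ 4 := by positivity
  refine lt_of_lt_of_le ?_ (hv.exp_mul_bump_le (ha_pos p) hR hε (lt_add_one _)
    (fun z hz => ⟨hamin hz, hA ⟨z, hz, rfl⟩, hB ⟨z, hz, rfl⟩⟩)
    (fun t x h => hnonneg t x (hsub h)) (fun t x h => hsup t x (hsub h)) (fun x hx => ?_) hcenter)
  · have hbump : bump R (ξ + s * T - s * T - ξ) = R ^ 4 := by rw [bump]; ring
    rw [hbump]
    positivity
  · rw [div_mul_cancel₀ _ (by positivity)]
    exact (hbase (lt_of_le_of_lt (abs_le.2 ⟨by linarith [hx.1], by linarith [hx.2]⟩) hRr)).le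

/-- A segment of `D` that advances in time has a slanted strip around it inside `D`, and there an
exponentially decaying bump is a barrier from below. -/
theorem pos_of_convex (hv : HasParabolicDerivs v vt vx vxx) (ha : Continuous a)
    (hb : Continuous b) (ha_pos : ∀ p, 0 < a p) {D : Set (ℝ × ℝ)} (hD : IsOpen D)
    (hDconv : Convex ℝ D) {t₀ x₀ T x₁ : ℝ} (hT : t₀ < T)
    (h₀ : (t₀, x₀) ∈ D) (h₁ : (T, x₁) ∈ D)
    (hnonneg : ∀ t ∈ Icc t₀ T, ∀ x, (t, x) ∈ D → 0 ≤ v t x)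
    (hsup : ∀ K, IsCompact K → ∃ M, ∀ t x, (t, x) ∈ K → t ∈ Icc t₀ T → (t, x) ∈ D →
      a (t, x) * vxx t x + b (t, x) * vx t x - M * v t x ≤ vt t x)
    (hpos : 0 < v t₀ x₀) : 0 < v T x₁ := by
  obtain ⟨s, hs⟩ : ∃ s, s = (x₁ - x₀) / (T - t₀) := ⟨_, rfl⟩
  have hTt₀ : 0 < T - t₀ := sub_pos.2 hT
  have hline : ∀ t ∈ Icc t₀ T, (t, x₀ - s * t₀ + s * t) ∈ D := by
    intro t ht
    convert hDconv.lineMap_mem h₀ h₁ (t := (t - t₀) / (T - t₀))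
      ⟨div_nonneg (sub_nonneg.2 ht.1) hTt₀.le, div_le_one_of_le₀ (by linarith [ht.2]) hTt₀.le⟩
      using 1
    simp only [AffineMap.lineMap_apply_module', Prod.mk_sub_mk, Prod.smul_mk, Prod.mk_add_mk,
      smul_eq_mul, Prod.mk.injEq, hs]
    constructor <;> field_simp <;> ring
  obtain ⟨ρ, hρ, hρD⟩ := (isCompact_Icc.image
    (show Continuous fun t => (t, x₀ - s * t₀ + s * t) by fun_prop)).exists_cthickening_subset_open
      hD (image_subset_iff.2 hline)
  have hstrip : slantedStrip t₀ T s (x₀ - s * t₀ - ρ) (x₀ - s * t₀ + ρ) ⊆ D := by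
    rintro ⟨t, x⟩ ⟨ht, hx⟩
    refine hρD (Metric.mem_cthickening_of_dist_le _ _ _ _ (mem_image_of_mem _ ht) ?_)
    rw [Prod.dist_eq, dist_self, Real.dist_eq]
    exact max_le hρ.le (abs_le.2 ⟨by linarith [hx.1], by linarith [hx.2]⟩)
  obtain ⟨M, hM⟩ := hsup _ (isCompact_slantedStrip t₀ T s (x₀ - s * t₀ - ρ) (x₀ - s * t₀ + ρ))
  have hend := hv.pos_of_slantedStrip ha hb ha_pos hT.le hρ
    (fun t x h => hnonneg t h.1 x (hstrip h)) (fun t x h => hM t x h h.1 (hstrip h))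
    (by simpa using hpos)
  rwa [show x₀ - s * t₀ + s * T = x₁ by rw [hs]; field_simp; ring] at hend

end HasParabolicDerivs

/-! ### Solutions and pulsating waves -/

variable {L c : ℝ} {a φ : ℝ → ℝ} {f : ℝ → ℝ → ℝ} {r q : ℝ → ℝ} {u u₁ u₂ : ℝ → ℝ → ℝ}

theorem deriv_mul_deriv {h : ℝ → ℝ} {x : ℝ} (ha : DifferentiableAt ℝ a x)
    (hh : DifferentiableAt ℝ (deriv h) x) :
    deriv (fun y => a y * deriv h y) x = a x * deriv (deriv h) x + deriv a x * deriv h x :=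
  (ha.hasDerivAt.mul hh.hasDerivAt).deriv.trans (add_comm _ _)

theorem hasParabolicDerivs_of_contDiff (hφ : ContDiff ℝ 2 φ) :
    HasParabolicDerivs (fun _ x => φ x) (fun _ _ => 0) (fun _ x => deriv φ x)
      (fun _ x => deriv (deriv φ) x) where
  cont := hφ.continuous.comp continuous_snd
  time t x := hasDerivAt_const t (φ x)
  space _ x := (hφ.differentiable two_ne_zero x).hasDerivAt
  space₂ _ x := ((hφ.deriv' (n := 1)).differentiable one_ne_zero x).hasDerivAt

namespace IsEntireSolution

theorem hasParabolicDerivs (ha : Differentiable ℝ a) (hu : IsEntireSolution a f u) :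
    HasParabolicDerivs u
      (fun t x => a x * deriv (deriv (u t)) x + deriv a x * deriv (u t) x + f x (u t x))
      (fun t x => deriv (u t) x) (fun t x => deriv (deriv (u t)) x) where
  cont := hu.cont
  time t x := by
    have := (hu.diff_t x t).hasDerivAt
    rwa [hu.eqn t x, deriv_mul_deriv (ha x) (hu.diff_xx t x)] at this
  space t x := (hu.diff_x t x).hasDerivAt
  space₂ t x := (hu.diff_xx t x).hasDerivAt

theorem continuous_space (hu : IsEntireSolution a f u) (t : ℝ) : Continuous (u t) :=
  (hu.diff_x t).continuous

theorem comp_add_const (hu : IsEntireSolution a f u) (s : ℝ) :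
    IsEntireSolution a f (fun t x => u (t + s) x) := by
  have hshift : Continuous fun z : ℝ × ℝ => (z.1 + s, z.2) := by fun_prop
  exact
    { cont := hu.cont.comp hshift
      diff_t := fun x => (hu.diff_t x).comp (differentiable_id.add_const s)
      diff_x := fun t => hu.diff_x (t + s)
      diff_xx := fun t => hu.diff_xx (t + s)
      cont_t := (hu.cont_t.comp hshift).congr fun z =>
        (deriv_comp_add_const (fun r => u r z.2) s z.1).symm
      cont_x := hu.cont_x.comp hshift
      cont_xx := hu.cont_xx.comp hshift
      eqn := fun t x =>
        (deriv_comp_add_const (fun r => u r x) s t).trans (hu.eqn (t + s) x) }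

end IsEntireSolution

theorem exists_lipschitz_on_compact (hf : ContDiff ℝ 1 fun z : ℝ × ℝ => f z.1 z.2)
    (h₁ : Continuous fun z : ℝ × ℝ => u₁ z.1 z.2) (h₂ : Continuous fun z : ℝ × ℝ => u₂ z.1 z.2)
    {K : Set (ℝ × ℝ)} (hK : IsCompact K) :
    ∃ M ≥ 0, ∀ t x, (t, x) ∈ K → |f x (u₁ t x) - f x (u₂ t x)| ≤ M * |u₁ t x - u₂ t x| := by
  have hgraphs : IsCompact ((fun z : ℝ × ℝ => (z.2, u₁ z.1 z.2)) '' K ∪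
      (fun z : ℝ × ℝ => (z.2, u₂ z.1 z.2)) '' K) :=
    (hK.image (by fun_prop)).union (hK.image (by fun_prop))
  obtain ⟨M, hM⟩ :=
    hf.locallyLipschitz.locallyLipschitzOn.exists_lipschitzOnWith_of_compact hgraphs
  refine ⟨M, M.2, fun t x htx => ?_⟩
  simpa [Prod.dist_eq, Real.dist_eq] using
    hM.dist_le_mul _ (Or.inl (mem_image_of_mem _ htx)) _ (Or.inr (mem_image_of_mem _ htx))

theorem IsEntireSolution.lt_of_le_of_lt (ha : ContDiff ℝ 1 a) (ha_pos : ∀ x, 0 < a x)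
    (hf : ContDiff ℝ 1 fun z : ℝ × ℝ => f z.1 z.2) (h₁ : IsEntireSolution a f u₁)
    (h₂ : IsEntireSolution a f u₂) {t₀ T x₀ x₁ : ℝ} (hT : t₀ < T)
    (hle : ∀ t ∈ Icc t₀ T, ∀ x, u₁ t x ≤ u₂ t x) (hlt : u₁ t₀ x₀ < u₂ t₀ x₀) :
    u₁ T x₁ < u₂ T x₁ := by
  have hdiff := (h₂.hasParabolicDerivs (ha.differentiable one_ne_zero)).sub
    (h₁.hasParabolicDerivs (ha.differentiable one_ne_zero))
  refine sub_pos.1 (hdiff.pos_of_convex (a := fun p => a p.2) (b := fun p => deriv a p.2)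
    (ha.continuous.comp continuous_snd) (ha.continuous_deriv_one.comp continuous_snd)
    (fun p => ha_pos p.2) isOpen_univ convex_univ hT (mem_univ (t₀, x₀)) (mem_univ _)
    (fun t ht x _ => sub_nonneg.2 (hle t ht x)) (fun K hK => ?_) (sub_pos.2 hlt))
  obtain ⟨M, -, hM⟩ := exists_lipschitz_on_compact hf h₂.cont h₁.cont hK
  refine ⟨M, fun t x htx ht _ => ?_⟩
  have hlip := neg_le_of_abs_le (hM t x htx)
  rw [abs_of_nonneg (sub_nonneg.2 (hle t ht x))] at hlip
  linarith

theorem Steeper.comp_add_const (h : Steeper u₁ u₂) (s : ℝ) :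
    Steeper (fun t x => u₁ (t + s) x) u₂ :=
  fun x₁ t₁ t₂ he => h x₁ (t₁ + s) t₂ he

theorem Steeper.le_of_le_of_le (h : Steeper u₁ u₂) {t x₀ x : ℝ} (hc₁ : Continuous (u₁ t))
    (hc₂ : Continuous (u₂ t)) (h₀ : u₁ t x₀ ≤ u₂ t x₀) (hx : x₀ ≤ x) : u₁ t x ≤ u₂ t x := by
  by_contra! hlt
  obtain ⟨y, hy, hcross⟩ := isPreconnected_Icc.intermediate_value₂ (left_mem_Icc.2 hx)
    (right_mem_Icc.2 hx) hc₁.continuousOn hc₂.continuousOn h₀ hlt.le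
  exact hlt.not_ge ((h y t t hcross).2 x hy.2)

theorem exists_pos_le_of_periodic {h : ℝ → ℝ} (hL : L ≠ 0) (hc : Continuous h)
    (hp : Function.Periodic h L) (hpos : ∀ x, 0 < h x) : ∃ η > 0, ∀ x, η ≤ h x := by
  obtain ⟨η, ⟨y, rfl⟩, hη⟩ :=
    (hp.compact_of_continuous hL hc).exists_isLeast (range_nonempty h)
  exact ⟨h y, hpos y, fun x => hη ⟨x, rfl⟩⟩

theorem exists_int_add_mul_mem_Ico {p : ℝ} (hp : p ≠ 0) (t b : ℝ) :
    ∃ n : ℤ, t + n * p ∈ Ico b (b + |p|) := by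
  obtain ⟨m, hm, -⟩ := existsUnique_add_zsmul_mem_Ico (abs_pos.2 hp) t b
  rw [zsmul_eq_mul] at hm
  rcases abs_choice p with h | h <;> rw [h] at hm ⊢
  · exact ⟨m, hm⟩
  · exact ⟨-m, by simpa using hm⟩

namespace IsPulsatingWave

theorem comp_add_const (hu : IsPulsatingWave L a f c r q u) (s : ℝ) :
    IsPulsatingWave L a f c r q (fun t x => u (t + s) x) where
  right_state := hu.right_state
  left_state := hu.left_state
  solution := hu.solution.comp_add_const s
  profile := by
    obtain ⟨P, hper, hP, hleft, hright⟩ := hu.profile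
    refine ⟨fun z => P (z - c * s), fun z => hper _, fun t x => ?_, fun V hV => ?_,
      fun V hV => ?_⟩
    · rw [hP, mul_add, ← sub_sub]
    · exact (tendsto_atBot_add_const_right atBot (-(c * s)) tendsto_id).eventually (hleft V hV)
    · exact (tendsto_atTop_add_const_right atTop (-(c * s)) tendsto_id).eventually (hright V hV)

theorem exists_left_state_sub_lt (hu : IsPulsatingWave L a f c r q u) {ε : ℝ} (hε : 0 < ε) :
    ∃ K, ∀ t x, x - c * t ≤ K → q x - ε < u t x := by
  obtain ⟨P, -, hP, hleft, -⟩ := hu.profile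
  obtain ⟨K, hK⟩ := eventually_atBot.1 (Metric.tendstoUniformly_iff.1 hleft ε hε)
  refine ⟨K, fun t x hx => ?_⟩
  have hclose : |q x - P (x - c * t) x| < ε := hK _ hx x
  rw [hP]
  linarith [(abs_lt.1 hclose).2]

theorem exists_lt_right_state_add (hu : IsPulsatingWave L a f c r q u) {ε : ℝ} (hε : 0 < ε) :
    ∃ K, ∀ t x, K ≤ x - c * t → u t x < r x + ε := by
  obtain ⟨P, -, hP, -, hright⟩ := hu.profile
  obtain ⟨K, hK⟩ := eventually_atTop.1 (Metric.tendstoUniformly_iff.1 hright ε hε)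
  refine ⟨K, fun t x hx => ?_⟩
  have hclose : |r x - P (x - c * t) x| < ε := hK _ hx x
  rw [hP]
  linarith [(abs_lt.1 hclose).1]

theorem exists_lt_of_le_sub_of_sub_le {c₁ c₂ : ℝ} {r₁ r₂ : ℝ → ℝ} (hL : L ≠ 0)
    (h₁ : IsPulsatingWave L a f c₁ r₁ q u₁) (h₂ : IsPulsatingWave L a f c₂ r₂ q u₂)
    (hr₁ : ∀ x, r₁ x < q x) :
    ∃ K₁ K₂, ∀ t₁ t₂ x, K₁ ≤ x - c₁ * t₁ → x - c₂ * t₂ ≤ K₂ → u₁ t₁ x < u₂ t₂ x := by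
  obtain ⟨η, hη, hgap⟩ := exists_pos_le_of_periodic hL
    (h₁.left_state.smooth.continuous.sub h₁.right_state.smooth.continuous)
    (h₁.left_state.periodic.sub h₁.right_state.periodic) fun x => sub_pos.2 (hr₁ x)
  obtain ⟨K₁, hK₁⟩ := h₁.exists_lt_right_state_add (half_pos hη)
  obtain ⟨K₂, hK₂⟩ := h₂.exists_left_state_sub_lt (half_pos hη)
  refine ⟨K₁, K₂, fun t₁ t₂ x hx₁ hx₂ => ?_⟩
  have hgap_x : η ≤ q x - r₁ x := hgap x
  linarith [hK₁ t₁ x hx₁, hK₂ t₂ x hx₂]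

theorem apply_add_int_mul_period (hu : IsPulsatingWave L a f c r q u) (hc : c ≠ 0) (n : ℤ)
    (t x : ℝ) : u (t + n * (L / c)) (x + n * L) = u t x := by
  obtain ⟨P, hper, hP, -, -⟩ := hu.profile
  rw [hP, hP, show x + n * L - c * (t + n * (L / c)) = x - c * t by field_simp; ring]
  exact (hper _).int_mul n x

end IsPulsatingWave

/-! ### Comparison modulo a supersolution of the linearized equation -/

/-- The function `V` for which the positive function `φ` solves `(a φ')' + V φ = 0`. It lets
comparison arguments use `φ` without reference to the linearized operator. -/
noncomputable def potential (a φ : ℝ → ℝ) (x : ℝ) : ℝ :=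
  -deriv (fun y => a y * deriv φ y) x / φ x

/-- `φ` is a positive `L`-periodic supersolution of the equation linearized at any state with
values in `[q - δ, q]`. This is what an eigenfunction for a nonpositive principal eigenvalue
provides. -/
structure IsLinearizedSupersolution (L δ : ℝ) (a : ℝ → ℝ) (f : ℝ → ℝ → ℝ) (q φ : ℝ → ℝ) :
    Prop where
  smooth : ContDiff ℝ 2 φ
  periodic : Function.Periodic φ L
  pos : ∀ x, 0 < φ x
  supersol : ∀ x, ∀ u ∈ Icc (q x - δ) (q x),
    deriv (fun y => a y * deriv φ y) x + deriv (f x) u * φ x ≤ 0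

theorem IsPrincipalEigenvalue.exists_isLinearizedSupersolution {δ μ : ℝ} {g : ℝ → ℝ}
    (hμ : IsPrincipalEigenvalue L a g μ) (hμ_nonpos : μ ≤ 0)
    (hfg : ∀ x, ∀ u ∈ Icc (q x - δ) (q x), deriv (f x) u ≤ g x) :
    ∃ φ, IsLinearizedSupersolution L δ a f q φ := by
  obtain ⟨φ, hφ, hper, hpos, heq⟩ := hμ
  refine ⟨φ, hφ, hper, hpos, fun x u hu => ?_⟩
  calc deriv (fun y => a y * deriv φ y) x + deriv (f x) u * φ x
      ≤ deriv (fun y => a y * deriv φ y) x + g x * φ x := by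
        gcongr
        exacts [(hpos x).le, hfg x u hu]
    _ = μ * φ x := heq x
    _ ≤ 0 := mul_nonpos_of_nonpos_of_nonneg hμ_nonpos (hpos x).le

theorem mul_deriv_deriv_add_eq_neg_potential_mul (ha : Differentiable ℝ a) (hφ : ContDiff ℝ 2 φ)
    {x : ℝ} (hx : φ x ≠ 0) :
    a x * deriv (deriv φ) x + deriv a x * deriv φ x = -(potential a φ x * φ x) := by
  rw [← deriv_mul_deriv (ha x) ((hφ.deriv' (n := 1)).differentiable one_ne_zero x), potential]
  field_simp

theorem continuous_potential (ha : ContDiff ℝ 1 a) (hφ : ContDiff ℝ 2 φ) (hpos : ∀ x, 0 < φ x) :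
    Continuous (potential a φ) := by
  have hφ' : ContDiff ℝ 1 (deriv φ) := hφ.deriv'
  have hexpand : (fun x => deriv (fun y => a y * deriv φ y) x) =
      fun x => a x * deriv (deriv φ) x + deriv a x * deriv φ x := funext fun x =>
    deriv_mul_deriv (ha.differentiable one_ne_zero x) (hφ'.differentiable one_ne_zero x)
  have hflux : Continuous fun x => deriv (fun y => a y * deriv φ y) x := by
    rw [hexpand]
    exact (ha.continuous.mul hφ'.continuous_deriv_one).add
      (ha.continuous_deriv_one.mul hφ'.continuous)
  exact hflux.neg.div hφ.continuous fun x => (hpos x).ne'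

theorem hasParabolicDerivs_const_mul_sub_sub (ha : Differentiable ℝ a) (hφ : ContDiff ℝ 2 φ)
    (hpos : ∀ x, 0 < φ x) (h₁ : IsEntireSolution a f u₁) (h₂ : IsEntireSolution a f u₂) (m : ℝ) :
    HasParabolicDerivs (fun t x => m * φ x - (u₁ t x - u₂ t x))
      (fun t x =>
        a x * (m * deriv (deriv φ) x - (deriv (deriv (u₁ t)) x - deriv (deriv (u₂ t)) x)) +
        deriv a x * (m * deriv φ x - (deriv (u₁ t) x - deriv (u₂ t) x)) +
        (potential a φ x * (m * φ x) - (f x (u₁ t x) - f x (u₂ t x))))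
      (fun t x => m * deriv φ x - (deriv (u₁ t) x - deriv (u₂ t) x))
      (fun t x => m * deriv (deriv φ) x - (deriv (deriv (u₁ t)) x - deriv (deriv (u₂ t)) x)) := by
  convert ((hasParabolicDerivs_of_contDiff hφ).const_mul m).sub
    ((h₁.hasParabolicDerivs ha).sub (h₂.hasParabolicDerivs ha)) using 3 with t x
  linear_combination m * mul_deriv_deriv_add_eq_neg_potential_mul ha hφ (hpos x).ne'

namespace IsLinearizedSupersolution

variable {δ : ℝ}

theorem deriv_le_potential (hφ : IsLinearizedSupersolution L δ a f q φ) {x w : ℝ}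
    (hw : w ∈ Icc (q x - δ) (q x)) : deriv (f x) w ≤ potential a φ x := by
  rw [potential, le_div_iff₀ (hφ.pos x)]
  linarith [hφ.supersol x w hw]

theorem reaction_sub_le (hφ : IsLinearizedSupersolution L δ a f q φ)
    (hf : ContDiff ℝ 1 fun z : ℝ × ℝ => f z.1 z.2) {x v w : ℝ} (hv : q x - δ ≤ v) (hvw : v ≤ w)
    (hw : w ≤ q x) : f x w - f x v ≤ potential a φ x * (w - v) := by
  have hfx : Differentiable ℝ (f x) :=
    (hf.differentiable one_ne_zero).comp (by fun_prop : Differentiable ℝ fun y : ℝ => (x, y))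
  exact (convex_Icc (q x - δ) (q x)).image_sub_le_mul_sub_of_deriv_le
    hfx.continuous.continuousOn hfx.differentiableOn
    (fun y hy => hφ.deriv_le_potential (interior_subset hy))
    v ⟨hv, hvw.trans hw⟩ w ⟨hv.trans hvw, hw⟩ hvw

theorem reaction_sub_sub_le (hφ : IsLinearizedSupersolution L δ a f q φ)
    (hf : ContDiff ℝ 1 fun z : ℝ × ℝ => f z.1 z.2) {x v w m B M : ℝ} (hm : 0 ≤ m)
    (hB : |potential a φ x| ≤ B) (hM₀ : 0 ≤ M) (hM : |f x w - f x v| ≤ M * |w - v|)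
    (hv : q x - δ ≤ v) (hw : w ≤ q x) (hle : w - v ≤ m * φ x) :
    f x w - f x v - potential a φ x * (m * φ x) ≤ (B + M) * (m * φ x - (w - v)) := by
  have hmφ : 0 ≤ m * φ x := mul_nonneg hm (hφ.pos x).le
  have hB' : -potential a φ x ≤ B := (neg_le_abs _).trans hB
  have hB₀ : 0 ≤ B := (abs_nonneg _).trans hB
  rcases le_total v w with hvw | hwv
  · calc f x w - f x v - potential a φ x * (m * φ x)
        ≤ potential a φ x * (w - v) - potential a φ x * (m * φ x) := by
          gcongr
          exact hφ.reaction_sub_le hf hv hvw hw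
      _ = -potential a φ x * (m * φ x - (w - v)) := by ring
      _ ≤ (B + M) * (m * φ x - (w - v)) :=
          mul_le_mul_of_nonneg_right (by linarith) (sub_nonneg.2 hle)
  · calc f x w - f x v - potential a φ x * (m * φ x)
        ≤ M * (v - w) + B * (m * φ x) := by
          rw [abs_of_nonpos (sub_nonpos.2 hwv), neg_sub] at hM
          have := mul_le_mul_of_nonneg_right hB' hmφ
          linarith [le_abs_self (f x w - f x v)]
      _ ≤ M * (m * φ x - (w - v)) + B * (m * φ x - (w - v)) :=
          add_le_add (mul_le_mul_of_nonneg_left (by linarith) hM₀)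
            (mul_le_mul_of_nonneg_left (by linarith) hB₀)
      _ = (B + M) * (m * φ x - (w - v)) := by ring

theorem sub_le_mul_on_slantedStrip (hφ : IsLinearizedSupersolution L δ a f q φ)
    (ha : ContDiff ℝ 1 a) (ha_pos : ∀ x, 0 < a x) (hf : ContDiff ℝ 1 fun z : ℝ × ℝ => f z.1 z.2)
    (h₁ : IsEntireSolution a f u₁) (h₂ : IsEntireSolution a f u₂) {t₀ T s α β ε : ℝ} (hε : 0 ≤ ε)
    (hband : ∀ t x, (t, x) ∈ slantedStrip t₀ T s α β → u₁ t x ≤ q x ∧ q x - δ ≤ u₂ t x)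
    (hbase : ∀ x, x - s * t₀ ∈ Icc α β → u₁ t₀ x - u₂ t₀ x ≤ ε * φ x)
    (hleft : ∀ t ∈ Icc t₀ T, u₁ t (α + s * t) - u₂ t (α + s * t) ≤ ε * φ (α + s * t))
    (hright : ∀ t ∈ Icc t₀ T, u₁ t (β + s * t) - u₂ t (β + s * t) ≤ ε * φ (β + s * t))
    {t x : ℝ} (htx : (t, x) ∈ slantedStrip t₀ T s α β) : u₁ t x - u₂ t x ≤ ε * φ x := by
  obtain ⟨B, hB⟩ := (isCompact_slantedStrip t₀ T s α β).bddAbove_image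
    ((continuous_potential ha hφ.smooth hφ.pos).comp continuous_snd).continuousOn
  refine sub_nonneg.1 ((hasParabolicDerivs_const_mul_sub_sub (ha.differentiable one_ne_zero)
    hφ.smooth hφ.pos h₁ h₂ ε).nonneg_on_slantedStrip (Λ := B + 1)
    (fun y hy => sub_nonneg.2 (hbase y hy)) (fun r hr => sub_nonneg.2 (hleft r hr))
    (fun r hr => sub_nonneg.2 (hright r hr)) (fun r hr y hy hneg hvx hvxx => ?_) htx)
  have hmem : (r, y) ∈ slantedStrip t₀ T s α β :=
    ⟨Ioc_subset_Icc_self hr, Ioo_subset_Icc_self hy⟩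
  have hεφ : 0 ≤ ε * φ y := mul_nonneg hε (hφ.pos y).le
  have hreaction := hφ.reaction_sub_le hf (hband r y hmem).2 (by linarith) (hband r y hmem).1
  have hV : potential a φ y ≤ B := hB ⟨_, hmem, rfl⟩
  have hdiffusion := mul_nonneg (ha_pos y).le hvxx
  have hdamping := mul_lt_mul_of_neg_right (hV.trans_lt (lt_add_one B)) hneg
  rw [hvx, mul_zero]
  linarith

theorem sub_lt_mul_of_convex (hφ : IsLinearizedSupersolution L δ a f q φ)
    (ha : ContDiff ℝ 1 a) (ha_pos : ∀ x, 0 < a x) (hf : ContDiff ℝ 1 fun z : ℝ × ℝ => f z.1 z.2)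
    (h₁ : IsEntireSolution a f u₁) (h₂ : IsEntireSolution a f u₂) {D : Set (ℝ × ℝ)} {m : ℝ}
    (hm : 0 ≤ m) (hD : IsOpen D) (hDconv : Convex ℝ D)
    (hband : ∀ t x, (t, x) ∈ D → u₁ t x ≤ q x ∧ q x - δ ≤ u₂ t x)
    (hle : ∀ t x, (t, x) ∈ D → u₁ t x - u₂ t x ≤ m * φ x) {t₀ x₀ T x₁ : ℝ} (hT : t₀ < T)
    (hmem₀ : (t₀, x₀) ∈ D) (hmem₁ : (T, x₁) ∈ D) (hlt : u₁ t₀ x₀ - u₂ t₀ x₀ < m * φ x₀) :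
    u₁ T x₁ - u₂ T x₁ < m * φ x₁ := by
  refine sub_pos.1 ((hasParabolicDerivs_const_mul_sub_sub (ha.differentiable one_ne_zero)
    hφ.smooth hφ.pos h₁ h₂ m).pos_of_convex (a := fun p => a p.2) (b := fun p => deriv a p.2)
    (ha.continuous.comp continuous_snd) (ha.continuous_deriv_one.comp continuous_snd)
    (fun p => ha_pos p.2) hD hDconv hT hmem₀ hmem₁
    (fun t _ x hx => sub_nonneg.2 (hle t x hx)) (fun K hK => ?_) (sub_pos.2 hlt))
  obtain ⟨M, hM₀, hM⟩ := exists_lipschitz_on_compact hf h₁.cont h₂.cont hK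
  obtain ⟨B, hB⟩ := hK.bddAbove_image
    ((continuous_potential ha hφ.smooth hφ.pos).comp continuous_snd).abs.continuousOn
  refine ⟨B + M, fun t x htx _ hx => ?_⟩
  linarith [hφ.reaction_sub_sub_le hf hm (hB ⟨_, htx, rfl⟩) hM₀ (hM t x htx) (hband t x hx).2
    (hband t x hx).1 (hle t x hx)]

theorem exists_sub_lt_mul (hφ : IsLinearizedSupersolution L δ a f q φ) (hL : L ≠ 0)
    (h₂ : IsPulsatingWave L a f c r q u₂) (hq : ∀ t x, u₁ t x ≤ q x) {ε : ℝ} (hε : 0 < ε) :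
    ∃ K, ∀ t x, x - c * t ≤ K → u₁ t x - u₂ t x < ε * φ x := by
  obtain ⟨φ₀, hφ₀, hφ_ge⟩ := exists_pos_le_of_periodic hL hφ.smooth.continuous hφ.periodic hφ.pos
  obtain ⟨K, hK⟩ := h₂.exists_left_state_sub_lt (mul_pos hε hφ₀)
  refine ⟨K, fun t x hx => ?_⟩
  have hεφ : ε * φ₀ ≤ ε * φ x := by gcongr; exact hφ_ge x
  linarith [hK t x hx, hq t x]

theorem le_of_le_on_line_of_lt_speed {c₁ c₂ K K₁ T : ℝ}
    (hφ : IsLinearizedSupersolution L δ a f q φ) (hL : L ≠ 0) (ha : ContDiff ℝ 1 a)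
    (ha_pos : ∀ x, 0 < a x) (hf : ContDiff ℝ 1 fun z : ℝ × ℝ => f z.1 z.2)
    (h₁ : IsEntireSolution a f u₁) (h₂ : IsPulsatingWave L a f c₂ r q u₂)
    (hq : ∀ t x, u₁ t x ≤ q x) (hc : c₂ < c₁) (hδ : ∀ t x, x - c₂ * t ≤ K → q x - δ ≤ u₂ t x)
    (hright : ∀ t x, K₁ ≤ x - c₁ * t → x - c₂ * t ≤ K → u₁ t x ≤ u₂ t x)
    (hline : ∀ t ≤ T, u₁ t (K + c₂ * t) ≤ u₂ t (K + c₂ * t)) {t x : ℝ} (ht : t ≤ T)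
    (hx : x - c₂ * t ≤ K) : u₁ t x ≤ u₂ t x := by
  suffices hle : ∀ ε > 0, u₁ t x - u₂ t x ≤ ε * φ x by
    refine sub_nonpos.1 (le_of_forall_pos_le_add fun η hη => ?_)
    simpa [div_mul_cancel₀ _ (hφ.pos x).ne'] using hle (η / φ x) (div_pos hη (hφ.pos x))
  intro ε hε
  obtain ⟨K₂, hfar⟩ := hφ.exists_sub_lt_mul hL h₂ hq hε
  obtain ⟨t₀, ht₀, hearly⟩ : ∃ t₀ ≤ t, (c₁ - c₂) * t₀ ≤ K₂ - K₁ :=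
    ((eventually_le_atBot t).and ((tendsto_id.const_mul_atBot
      (sub_pos.2 hc)).eventually_le_atBot (K₂ - K₁))).exists
  have hle_mul : ∀ s y, u₁ s y ≤ u₂ s y → u₁ s y - u₂ s y ≤ ε * φ y := fun s y h =>
    (sub_nonpos.2 h).trans (mul_pos hε (hφ.pos y)).le
  refine hφ.sub_le_mul_on_slantedStrip ha ha_pos hf h₁ h₂.solution (t₀ := t₀) (T := t) (s := c₂)
    (α := min K₂ (x - c₂ * t)) (β := K) hε.le (fun s y h => ⟨hq s y, hδ s y h.2.2⟩) ?_ ?_ ?_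
    ⟨⟨ht₀, le_rfl⟩, min_le_right _ _, hx⟩
  · intro y hy
    rcases le_or_gt K₁ (y - c₁ * t₀) with h | h
    · exact hle_mul t₀ y (hright t₀ y h hy.2)
    · exact (hfar t₀ y (by linarith)).le
  · exact fun s _ => (hfar s _ (by simp)).le
  · exact fun s hs => hle_mul s _ (hline s (hs.2.trans ht))

end IsLinearizedSupersolution

theorem exists_isMaxOn_of_invariant {F : ℝ × ℝ → ℝ} (hF : Continuous F) (hL : L ≠ 0) (hc : c ≠ 0)
    (hinv : ∀ (n : ℤ) t x, F (t + n * (L / c), x + n * L) = F (t, x)) {K₁ K m : ℝ}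
    (hfar : ∀ t x, x - c * t ≤ K₁ → F (t, x) < m) {t x : ℝ} (hx : x - c * t ≤ K)
    (hm : m ≤ F (t, x)) : ∃ z ∈ {p : ℝ × ℝ | p.2 - c * p.1 ≤ K},
      IsMaxOn F {p : ℝ × ℝ | p.2 - c * p.1 ≤ K} z := by
  have hreduce : ∀ t x, x - c * t ≤ K → m ≤ F (t, x) →
      ∃ p ∈ slantedStrip 0 |L / c| c K₁ K, F p = F (t, x) := by
    intro t x hx hmx
    obtain ⟨n, hn⟩ := exists_int_add_mul_mem_Ico (div_ne_zero hL hc) t 0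
    have hline : x + n * L - c * (t + n * (L / c)) = x - c * t := by field_simp; ring
    refine ⟨_, ⟨⟨hn.1, by simpa using hn.2.le⟩, ?_⟩, hinv n t x⟩
    rw [hline]
    exact ⟨le_of_lt (not_le.1 fun h => (hfar t x h).not_ge hmx), hx⟩
  obtain ⟨p, hp, hpF⟩ := hreduce t x hx hm
  obtain ⟨z, hz, hmax⟩ :=
    (isCompact_slantedStrip 0 |L / c| c K₁ K).exists_isMaxOn ⟨p, hp⟩ hF.continuousOn
  have hmz : m ≤ F z := hm.trans (hpF.symm.le.trans (hmax hp))
  refine ⟨z, hz.2.2, fun ⟨s, y⟩ hy => ?_⟩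
  rcases lt_or_ge (F (s, y)) m with hlt | hge
  · exact hlt.le.trans hmz
  · obtain ⟨p', hp', hp'F⟩ := hreduce s y hy hge
    exact hp'F.symm.le.trans (hmax hp')

theorem IsLinearizedSupersolution.sub_lt_mul_of_lt_on_line {δ K m : ℝ}
    (hφ : IsLinearizedSupersolution L δ a f q φ) (ha : ContDiff ℝ 1 a) (ha_pos : ∀ x, 0 < a x)
    (hf : ContDiff ℝ 1 fun z : ℝ × ℝ => f z.1 z.2) (h₁ : IsEntireSolution a f u₁)
    (h₂ : IsEntireSolution a f u₂) (hq : ∀ t x, u₁ t x ≤ q x)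
    (hδ : ∀ t x, x - c * t ≤ K → q x - δ ≤ u₂ t x) (hm : 0 ≤ m)
    (hle : ∀ t x, x - c * t ≤ K → u₁ t x - u₂ t x ≤ m * φ x)
    (hline : ∀ t, u₁ t (K + c * t) - u₂ t (K + c * t) < m * φ (K + c * t)) {t x : ℝ}
    (hx : x - c * t ≤ K) : u₁ t x - u₂ t x < m * φ x := by
  rcases hx.eq_or_lt with heq | hx
  · simpa [← heq] using hline t
  obtain ⟨x₀, hx₀, hx₀_lt⟩ : ∃ x₀, u₁ (t - 1) x₀ - u₂ (t - 1) x₀ < m * φ x₀ ∧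
      x₀ < K + c * (t - 1) := by
    have hnear : ∀ᶠ y in 𝓝 (K + c * (t - 1)), u₁ (t - 1) y - u₂ (t - 1) y < m * φ y :=
      (isOpen_lt ((h₁.continuous_space (t - 1)).sub (h₂.continuous_space (t - 1)))
        (hφ.smooth.continuous.const_mul m)).mem_nhds (hline (t - 1))
    exact ((hnear.filter_mono nhdsWithin_le_nhds).and
      (self_mem_nhdsWithin : ∀ᶠ y in 𝓝[<] (K + c * (t - 1)), y < K + c * (t - 1))).exists
  exact hφ.sub_lt_mul_of_convex ha ha_pos hf h₁ h₂ hm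
    (D := {p | p.2 - c * p.1 < K}) (isOpen_lt (by fun_prop) continuous_const)
    (convex_halfSpace_lt (IsLinearMap.mk (by intros; simp; ring) (by intros; simp; ring)) K)
    (fun s y h => ⟨hq s y, hδ s y (le_of_lt h)⟩) (fun s y h => hle s y (le_of_lt h))
    (sub_one_lt t) (show x₀ - c * (t - 1) < K by linarith) hx hx₀

/-- Where `(u₁ - u₂) / φ` attains a positive maximum `m`, the function `m φ` touches `u₁ - u₂`
from above, which the strong comparison principle forbids. -/
theorem IsLinearizedSupersolution.le_of_lt_on_line_of_speed_eq {δ K : ℝ} {r₁ r₂ : ℝ → ℝ}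
    (hφ : IsLinearizedSupersolution L δ a f q φ) (hL : L ≠ 0) (ha : ContDiff ℝ 1 a)
    (ha_pos : ∀ x, 0 < a x) (hf : ContDiff ℝ 1 fun z : ℝ × ℝ => f z.1 z.2)
    (h₁ : IsPulsatingWave L a f c r₁ q u₁) (h₂ : IsPulsatingWave L a f c r₂ q u₂)
    (hq : ∀ t x, u₁ t x ≤ q x) (hc : c ≠ 0) (hδ : ∀ t x, x - c * t ≤ K → q x - δ ≤ u₂ t x)
    (hline : ∀ t, u₁ t (K + c * t) < u₂ t (K + c * t)) {t x : ℝ} (hx : x - c * t ≤ K) :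
    u₁ t x ≤ u₂ t x := by
  by_contra! hlt
  have hm₀ : 0 < (u₁ t x - u₂ t x) / φ x := div_pos (sub_pos.2 hlt) (hφ.pos x)
  obtain ⟨K₁, hfar⟩ := hφ.exists_sub_lt_mul hL h₂ hq hm₀
  have hratio : Continuous fun p : ℝ × ℝ => (u₁ p.1 p.2 - u₂ p.1 p.2) / φ p.2 :=
    (h₁.solution.cont.sub h₂.solution.cont).div (hφ.smooth.continuous.comp continuous_snd)
      fun p => (hφ.pos p.2).ne'
  obtain ⟨⟨t₁, x₁⟩, hx₁, hmax⟩ := exists_isMaxOn_of_invariant hratio hL hc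
    (fun n s y => by simp only [h₁.apply_add_int_mul_period hc, h₂.apply_add_int_mul_period hc,
      hφ.periodic.int_mul n y])
    (fun s y hy => (div_lt_iff₀ (hφ.pos y)).2 (hfar s y hy)) hx le_rfl
  obtain ⟨m, hm⟩ : ∃ m, m = (u₁ t₁ x₁ - u₂ t₁ x₁) / φ x₁ := ⟨_, rfl⟩
  have hm_pos : 0 < m := hm ▸ hm₀.trans_le (hmax (show (t, x) ∈ _ from hx))
  have hle : ∀ s y, y - c * s ≤ K → u₁ s y - u₂ s y ≤ m * φ y := fun s y hy =>
    (div_le_iff₀ (hφ.pos y)).1 (hm ▸ hmax (show (s, y) ∈ _ from hy))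
  have htouch : u₁ t₁ x₁ - u₂ t₁ x₁ = m * φ x₁ := by rw [hm, div_mul_cancel₀ _ (hφ.pos x₁).ne']
  exact (hφ.sub_lt_mul_of_lt_on_line ha ha_pos hf h₁.solution h₂.solution hq hδ hm_pos.le hle
    (fun s => (sub_neg.2 (hline s)).trans (mul_pos hm_pos (hφ.pos _))) hx₁).ne htouch

/-! ### The steeper wave -/

theorem exists_eq_forall_lt_of_eventually_lt {g h : ℝ → ℝ} (hg : Continuous g) (hh : Continuous h)
    (hbot : ∀ᶠ t in atBot, g t < h t) (hex : ∃ t, h t ≤ g t) :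
    ∃ T, g T = h T ∧ ∀ t < T, g t < h t := by
  obtain ⟨t₀, ht₀⟩ := eventually_atBot.1 hbot
  have hbdd : BddBelow {t | h t ≤ g t} :=
    ⟨t₀, fun t ht => le_of_lt (not_le.1 fun htt₀ => (ht₀ t htt₀).not_ge ht)⟩
  have hbefore : ∀ t < sInf {t | h t ≤ g t}, g t < h t := fun t ht =>
    not_le.1 (notMem_of_lt_csInf (s := {t | h t ≤ g t}) ht hbdd)
  refine ⟨_, le_antisymm ?_ ((isClosed_le hh hg).csInf_mem hex hbdd), hbefore⟩
  refine le_of_tendsto_of_tendsto (b := 𝓝[<] sInf {t | h t ≤ g t})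
    ((hg.tendsto _).mono_left nhdsWithin_le_nhds) ((hh.tendsto _).mono_left nhdsWithin_le_nhds) ?_
  filter_upwards [self_mem_nhdsWithin] with t ht using (hbefore t ht).le

namespace IsPulsatingWave

variable {c₁ c₂ δ : ℝ} {r₁ r₂ : ℝ → ℝ}

theorem exists_lt_of_speed_lt (hL : L ≠ 0) (h₁ : IsPulsatingWave L a f c₁ r₁ q u₁)
    (h₂ : IsPulsatingWave L a f c₂ r₂ q u₂) (hr₂ : ∀ x, r₂ x < q x) (hc : c₂ < c₁) :
    ∃ t x, u₂ t x < u₁ t x := by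
  obtain ⟨K₂, K₁, hlt⟩ := h₂.exists_lt_of_le_sub_of_sub_le hL h₁ hr₂
  obtain ⟨t, ht⟩ := ((tendsto_id.const_mul_atTop (sub_pos.2 hc)).eventually_ge_atTop
    (K₂ - K₁)).exists
  exact ⟨t, K₂ + c₂ * t, hlt t t _ (by simp) (by simp only [id] at ht; linarith)⟩

theorem le_of_le_on_line_of_steeper {K K₁ T : ℝ} (hφ : IsLinearizedSupersolution L δ a f q φ)
    (hL : L ≠ 0) (ha : ContDiff ℝ 1 a) (ha_pos : ∀ x, 0 < a x)
    (hf : ContDiff ℝ 1 fun z : ℝ × ℝ => f z.1 z.2) (h₁ : IsEntireSolution a f u₁)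
    (h₂ : IsPulsatingWave L a f c₂ r₂ q u₂) (hq : ∀ t x, u₁ t x ≤ q x) (hsteep : Steeper u₁ u₂)
    (hc : c₂ < c₁) (hδ : ∀ t x, x - c₂ * t ≤ K → q x - δ ≤ u₂ t x)
    (hright : ∀ t x, K₁ ≤ x - c₁ * t → x - c₂ * t ≤ K → u₁ t x ≤ u₂ t x)
    (hline : ∀ t ≤ T, u₁ t (K + c₂ * t) ≤ u₂ t (K + c₂ * t)) {t : ℝ} (ht : t ≤ T) (x : ℝ) :
    u₁ t x ≤ u₂ t x := by
  rcases le_total (x - c₂ * t) K with hx | hx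
  · exact hφ.le_of_le_on_line_of_lt_speed hL ha ha_pos hf h₁ h₂ hq hc hδ hright hline ht hx
  · exact hsteep.le_of_le_of_le (h₁.continuous_space t) (h₂.solution.continuous_space t)
      (hline t ht) (by linarith)

theorem speed_le_of_steeper (hφ : IsLinearizedSupersolution L δ a f q φ) (hL : L ≠ 0)
    (ha : ContDiff ℝ 1 a) (ha_pos : ∀ x, 0 < a x)
    (hf : ContDiff ℝ 1 fun z : ℝ × ℝ => f z.1 z.2) (hδ : 0 < δ)
    (h₁ : IsPulsatingWave L a f c₁ r₁ q u₁) (h₂ : IsPulsatingWave L a f c₂ r₂ q u₂)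
    (hr₁ : ∀ x, r₁ x < q x) (hr₂ : ∀ x, r₂ x < q x) (hq : ∀ t x, u₁ t x ≤ q x)
    (hsteep : Steeper u₁ u₂) : c₁ ≤ c₂ := by
  by_contra! hc
  obtain ⟨K₁, K₂, hright⟩ := h₁.exists_lt_of_le_sub_of_sub_le hL h₂ hr₁
  obtain ⟨Kδ, hKδ⟩ := h₂.exists_left_state_sub_lt hδ
  obtain ⟨K, hKK₂, hKKδ⟩ : ∃ K, K ≤ K₂ ∧ K ≤ Kδ := ⟨_, min_le_left K₂ Kδ, min_le_right K₂ Kδ⟩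
  have hall : ∀ T, (∀ t ≤ T, u₁ t (K + c₂ * t) ≤ u₂ t (K + c₂ * t)) →
      ∀ t ≤ T, ∀ x, u₁ t x ≤ u₂ t x := fun T hline t ht x =>
    le_of_le_on_line_of_steeper hφ hL ha ha_pos hf h₁.solution h₂ hq hsteep hc
      (fun s y hy => (hKδ s y (hy.trans hKKδ)).le)
      (fun s y hy₁ hy₂ => (hright s s y hy₁ (hy₂.trans hKK₂)).le) hline ht x
  have hbot : ∀ᶠ t in atBot, u₁ t (K + c₂ * t) < u₂ t (K + c₂ * t) := by
    filter_upwards [(tendsto_id.const_mul_atBot (sub_pos.2 hc)).eventually_le_atBot (K - K₁)]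
      with t ht
    simp only [id] at ht
    exact hright t t _ (by linarith) (by linarith)
  have hex : ∃ t, u₂ t (K + c₂ * t) ≤ u₁ t (K + c₂ * t) := by
    by_contra! hline
    obtain ⟨t, x, hlt⟩ := h₁.exists_lt_of_speed_lt hL h₂ hr₂ hc
    exact hlt.not_ge (hall t (fun s _ => (hline s).le) t le_rfl x)
  have hcont : Continuous fun t : ℝ => (t, K + c₂ * t) := by fun_prop
  obtain ⟨T, hcross, hbefore⟩ := exists_eq_forall_lt_of_eventually_lt
    (h₁.solution.cont.comp hcont) (h₂.solution.cont.comp hcont) hbot hex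
  have hupto : ∀ t ≤ T, u₁ t (K + c₂ * t) ≤ u₂ t (K + c₂ * t) := fun t ht =>
    ht.eq_or_lt.elim (fun h => h ▸ hcross.le) fun h => (hbefore t h).le
  exact (h₁.solution.lt_of_le_of_lt ha ha_pos hf h₂.solution (sub_one_lt T)
    (fun t ht => hall T hupto t ht.2) (hbefore _ (sub_one_lt T))).ne hcross

theorem le_of_lt_on_line_of_steeper {K : ℝ} (hφ : IsLinearizedSupersolution L δ a f q φ)
    (hL : L ≠ 0) (ha : ContDiff ℝ 1 a) (ha_pos : ∀ x, 0 < a x)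
    (hf : ContDiff ℝ 1 fun z : ℝ × ℝ => f z.1 z.2)
    (h₁ : IsPulsatingWave L a f c r₁ q u₁) (h₂ : IsPulsatingWave L a f c r₂ q u₂)
    (hq : ∀ t x, u₁ t x ≤ q x) (hc : c ≠ 0) (hsteep : Steeper u₁ u₂)
    (hδ : ∀ t x, x - c * t ≤ K → q x - δ ≤ u₂ t x)
    (hline : ∀ t, u₁ t (K + c * t) < u₂ t (K + c * t)) (t x : ℝ) : u₁ t x ≤ u₂ t x := by
  rcases le_total (x - c * t) K with hx | hx
  · exact hφ.le_of_lt_on_line_of_speed_eq hL ha ha_pos hf h₁ h₂ hq hc hδ hline hx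
  · exact hsteep.le_of_le_of_le (h₁.solution.continuous_space t)
      (h₂.solution.continuous_space t) (hline t).le (by linarith)

theorem eq_or_lt_of_le (hL : L ≠ 0) (ha : ContDiff ℝ 1 a) (ha_pos : ∀ x, 0 < a x)
    (hf : ContDiff ℝ 1 fun z : ℝ × ℝ => f z.1 z.2) (hc : c ≠ 0)
    (h₁ : IsPulsatingWave L a f c r₁ q u₁) (h₂ : IsPulsatingWave L a f c r₂ q u₂)
    (hle : ∀ t x, u₁ t x ≤ u₂ t x) : u₁ = u₂ ∨ ∀ t x, u₁ t x < u₂ t x := by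
  by_contra! hne
  obtain ⟨hne, t, x, hge⟩ := hne
  refine hne (funext₂ fun t₀ x₀ => (hle t₀ x₀).eq_of_not_lt fun hlt => ?_)
  obtain ⟨n, hn⟩ := exists_int_add_mul_mem_Ico (div_ne_zero hL hc) t₀ (t - 1 - |L / c|)
  refine hge.not_gt (h₁.solution.lt_of_le_of_lt ha ha_pos hf h₂.solution
    (t₀ := t₀ + n * (L / c)) (x₀ := x₀ + n * L) (by linarith [hn.2]) (fun s _ y => hle s y) ?_)
  rwa [h₁.apply_add_int_mul_period hc, h₂.apply_add_int_mul_period hc]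

theorem eventually_lt_on_line (hL : L ≠ 0) (hc : c ≠ 0)
    (h₁ : IsPulsatingWave L a f c r₁ q u₁) (h₂ : IsPulsatingWave L a f c r₂ q u₂) {K : ℝ}
    (hlt : ∀ t, u₁ t (K + c * t) < u₂ t (K + c * t)) :
    ∀ᶠ s in 𝓝 0, ∀ t, u₁ (t + s) (K + c * t) < u₂ t (K + c * t) := by
  have hcompact : ∀ᶠ s in 𝓝 0, ∀ t ∈ Icc 0 |L / c|,
      u₁ (t + s) (K + c * t) < u₂ t (K + c * t) := by
    refine isCompact_Icc.eventually_forall_of_forall_eventually fun t _ => ?_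
    have hcont₁ : Continuous fun z : ℝ × ℝ => u₁ (z.2 + z.1) (K + c * z.2) :=
      h₁.solution.cont.comp (by fun_prop : Continuous fun z : ℝ × ℝ => (z.2 + z.1, K + c * z.2))
    have hcont₂ : Continuous fun z : ℝ × ℝ => u₂ z.2 (K + c * z.2) :=
      h₂.solution.cont.comp (by fun_prop : Continuous fun z : ℝ × ℝ => (z.2, K + c * z.2))
    exact (isOpen_lt hcont₁ hcont₂).mem_nhds (by simpa using hlt t)
  filter_upwards [hcompact] with s hs t
  obtain ⟨n, hn⟩ := exists_int_add_mul_mem_Ico (div_ne_zero hL hc) t 0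
  have hshift := hs (t + n * (L / c)) ⟨hn.1, by simpa using hn.2.le⟩
  rwa [show K + c * (t + n * (L / c)) = K + c * t + n * L by field_simp; ring, add_right_comm,
    h₁.apply_add_int_mul_period hc, h₂.apply_add_int_mul_period hc] at hshift

/-- The required time shift is the largest one, in units of distance travelled, for which the
shifted `u₁` stays below `u₂`: if the two were then strictly ordered, the ordering on a moving
line would survive a slightly larger shift. -/
theorem exists_eq_add_const_of_steeper (hφ : IsLinearizedSupersolution L δ a f q φ) (hL : L ≠ 0)
    (ha : ContDiff ℝ 1 a) (ha_pos : ∀ x, 0 < a x)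
    (hf : ContDiff ℝ 1 fun z : ℝ × ℝ => f z.1 z.2) (hδ : 0 < δ) (hc : c ≠ 0)
    (h₁ : IsPulsatingWave L a f c r₁ q u₁) (h₂ : IsPulsatingWave L a f c r₂ q u₂)
    (hr₁ : ∀ x, r₁ x < q x) (hr₂ : ∀ x, r₂ x < q x) (hq : ∀ t x, u₁ t x ≤ q x)
    (hsteep : Steeper u₁ u₂) : ∃ τ, ∀ t x, u₂ t x = u₁ (t + τ) x := by
  obtain ⟨K₁, K₂, hright⟩ := h₁.exists_lt_of_le_sub_of_sub_le hL h₂ hr₁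
  obtain ⟨K₂', K₁', hleft⟩ := h₂.exists_lt_of_le_sub_of_sub_le hL h₁ hr₂
  obtain ⟨Kδ, hKδ⟩ := h₂.exists_left_state_sub_lt hδ
  obtain ⟨K, hKK₂, hKKδ⟩ : ∃ K, K ≤ K₂ ∧ K ≤ Kδ := ⟨_, min_le_left K₂ Kδ, min_le_right K₂ Kδ⟩
  let S : Set ℝ := {σ | ∀ t x, u₁ (t + σ / c) x ≤ u₂ t x}
  have hline : ∀ σ, (∀ t, u₁ (t + σ / c) (K + c * t) < u₂ t (K + c * t)) → σ ∈ S := fun σ hlt =>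
    le_of_lt_on_line_of_steeper hφ hL ha ha_pos hf (h₁.comp_add_const (σ / c)) h₂
      (fun t => hq (t + σ / c)) hc (hsteep.comp_add_const (σ / c))
      (fun t x hx => (hKδ t x (hx.trans hKKδ)).le) hlt
  have hne : S.Nonempty :=
    ⟨K - K₁, hline _ fun t => hright _ _ _ (by field_simp; linarith) (by linarith)⟩
  have hbdd : BddAbove S := by
    refine ⟨K₂' - K₁', fun σ hσ => ?_⟩
    by_contra! hlt
    refine (hσ 0 K₂').not_gt (hleft _ _ _ (by simp) ?_)
    field_simp
    linarith
  have hclosed : IsClosed S := by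
    simp only [S, ofPred_forall]
    refine isClosed_iInter fun t => isClosed_iInter fun x => isClosed_le ?_ continuous_const
    exact h₁.solution.cont.comp (by fun_prop : Continuous fun σ : ℝ => (t + σ / c, x))
  obtain ⟨σ, hσ⟩ : ∃ σ, IsGreatest S σ :=
    ⟨sSup S, hclosed.csSup_mem hne hbdd, fun _ => le_csSup hbdd⟩
  have hσ_wave := h₁.comp_add_const (σ / c)
  rcases hσ_wave.eq_or_lt_of_le hL ha ha_pos hf hc h₂ hσ.1 with heq | hlt
  · exact ⟨σ / c, fun t x => (congrFun₂ heq t x).symm⟩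
  · have hsmall : Tendsto (fun ε => ε / c) (𝓝[>] 0) (𝓝 0) := by
      simpa using ((continuous_id.div_const c).tendsto 0).mono_left nhdsWithin_le_nhds
    obtain ⟨ε, hε_lt, hε⟩ := ((hsmall.eventually (hσ_wave.eventually_lt_on_line hL hc h₂
      (K := K) fun t => hlt t _)).and self_mem_nhdsWithin).exists
    refine absurd (hσ.2 (hline (σ + ε) fun t => ?_)) (not_le.2 (lt_add_of_pos_right σ hε))
    rw [show t + (σ + ε) / c = t + ε / c + σ / c by ring]
    exact hε_lt t

end IsPulsatingWave

end PeriodicRD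

theorem mainTheorem3_general
    {L : ℝ} (hL : L ≠ 0)
    {a : ℝ → ℝ} (ha : ContDiff ℝ 1 a) (ha_pos : ∀ x, 0 < a x)
    {f : ℝ → ℝ → ℝ} (hf : ContDiff ℝ 1 fun z : ℝ × ℝ => f z.1 z.2)
    {q q₁ q₂ : ℝ → ℝ} (hq₁ : ∀ x, q₁ x < q x) (hq₂ : ∀ x, q₂ x < q x)
    {c₁ c₂ : ℝ} {U₁ U₂ : ℝ → ℝ → ℝ}
    (hU₁ : PeriodicRD.IsPulsatingWave L a f c₁ q₁ q U₁)
    (hU₂ : PeriodicRD.IsPulsatingWave L a f c₂ q₂ q U₂)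
    (hU₁q : ∀ t x, U₁ t x ≤ q x)
    {δ : ℝ} (hδ : 0 < δ) {φ : ℝ → ℝ}
    (hφ : PeriodicRD.IsLinearizedSupersolution L δ a f q φ)
    (hsteep : PeriodicRD.Steeper U₁ U₂) :
    c₁ ≤ c₂ ∧
      (c₁ = c₂ → c₁ ≠ 0 → ∃ τ : ℝ, ∀ t x, U₂ t x = U₁ (t + τ) x) := by
  refine ⟨PeriodicRD.IsPulsatingWave.speed_le_of_steeper hφ hL ha ha_pos hf hδ hU₁ hU₂ hq₁ hq₂ hU₁q
    hsteep, ?_⟩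
  rintro rfl hc
  exact PeriodicRD.IsPulsatingWave.exists_eq_add_const_of_steeper hφ hL ha ha_pos hf hδ hc hU₁ hU₂
    hq₁ hq₂ hU₁q hsteep

theorem mainTheorem3
    (L : ℝ) (hL : 0 < L)
    (a : ℝ → ℝ) (ha : ContDiff ℝ 2 a) (ha_pos : ∀ x, 0 < a x) (ha_per : Function.Periodic a L)
    (f : ℝ → ℝ → ℝ) (hf : ContDiff ℝ 1 fun z : ℝ × ℝ => f z.1 z.2)
    (hf_per : ∀ x u, f (x + L) u = f x u)
    (q q₁ q₂ : ℝ → ℝ) (hq₁ : ∀ x, q₁ x < q x) (hq₂ : ∀ x, q₂ x < q x)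
    (c₁ c₂ : ℝ) (U₁ U₂ : ℝ → ℝ → ℝ)
    (hU₁ : PeriodicRD.IsPulsatingWave L a f c₁ q₁ q U₁)
    (hU₂ : PeriodicRD.IsPulsatingWave L a f c₂ q₂ q U₂)
    (hU₁q : ∀ t x, U₁ t x ≤ q x)
    (δ : ℝ) (hδ : 0 < δ)
    (g : ℝ → ℝ) (hg : Function.Periodic g L)
    (μ : ℝ) (hμ : PeriodicRD.IsPrincipalEigenvalue L a g μ) (hμ_nonpos : μ ≤ 0)
    (hfg : ∀ x, ∀ u ∈ Set.Icc (q x - δ) (q x), deriv (f x) u ≤ g x)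
    (hsteep : PeriodicRD.Steeper U₁ U₂) :
    c₁ ≤ c₂ ∧
      (c₁ = c₂ → c₁ ≠ 0 → ∃ τ : ℝ, ∀ t x, U₂ t x = U₁ (t + τ) x) := by
  obtain ⟨φ, hφ⟩ := hμ.exists_isLinearizedSupersolution hμ_nonpos hfg
  exact mainTheorem3_general hL.ne' (ha.of_le one_le_two) ha_pos hf hq₁ hq₂ hU₁ hU₂ hU₁q hδ hφ
    hsteep
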